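/- Let $m\ge 0$ be an integer and let $f,g\in\mathbb{C}[x]$ be polynomials with $\deg f=m$, $\deg g=2m+1$ and leading coefficients $f_0$, $g_0$ satisfying $4(m+1)g_0=f_0^2$. Consider the Liénard differential system $$x_t=y,\qquad y_t=-f(x)y-g(x)$$ in $\mathbb{C}^2$. A first integral of the system on a domain (non-empty connected open set) $D\subset\mathbb{C}^2$ is a non-constant function $I:D\to\mathbb{C}$ that is constant along every solution $(x(t),y(t))$ lying in $D$. The system is called Darboux integrable if on some domain $D$ it has a first integral of the form $I=F_1^{d_1}\cdots F_K^{d_K}\exp(R)$ (a Darboux first integral), where $F_1,\dots,F_K\in\mathbb{C}[x,y]$, $d_1,\dots,d_K\in\mathbb{C}$, $R\in\mathbb{C}(x,y)$. The system is Darboux integrable if and only if it can be represented in the form $$x_t=y,\qquad y_t=2q_x(x)\,y-q(x)q_x(x)$$ with a polynomial $q\in\mathbb{C}[x]$ of degree $m+1$. In this case $$I(x,y)=[y-q(x)]\exp\left[-\frac{q(x)}{y-q(x)}\right]$$ is a Darboux first integral of the system on $D=\{(x,y)\in\mathbb{C}^2: y\neq q(x)\}$. -/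

import Mathlib

open Polynomial

/-- `bival F p` is the value `F(x, y)` at `p = (x, y) ∈ ℂ²` of a polynomial `F ∈ ℂ[x, y]`. The ring
`ℂ[x, y]` is written as `ℂ[x][y]`: the inner variable is `x`, the outer one is `y`. -/
noncomputable def bival (F : ℂ[X][X]) (p : ℂ × ℂ) : ℂ := F.evalEval p.1 p.2

/-- `z` is a solution of `x_t = P(x, y)`, `y_t = Q(x, y)` on the set `T` of times; time is real
(`𝕜 = ℝ`) or complex (`𝕜 = ℂ`). -/
def IsSolutionOn {𝕜 : Type} [NontriviallyNormedField 𝕜] [NormedSpace 𝕜 ℂ] (P Q : ℂ[X][X])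
    (T : Set 𝕜) (z : 𝕜 → ℂ × ℂ) : Prop :=
  ∀ t ∈ T, HasDerivAt z (bival P (z t), bival Q (z t)) t

/-- `I` is constant along every solution that lies in `D` and is defined on an open connected set of
times in `𝕜`. -/
def ConstantAlongSolutions (𝕜 : Type) [NontriviallyNormedField 𝕜] [NormedSpace 𝕜 ℂ]
    (P Q : ℂ[X][X]) (D : Set (ℂ × ℂ)) (I : ℂ × ℂ → ℂ) : Prop :=
  ∀ (T : Set 𝕜) (z : 𝕜 → ℂ × ℂ), IsOpen T → IsPreconnected T → IsSolutionOn P Q T z →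
    (∀ t ∈ T, z t ∈ D) → ∀ s ∈ T, ∀ t ∈ T, I (z s) = I (z t)

/-- `I` is a first integral of `x_t = P(x, y)`, `y_t = Q(x, y)` on the domain `D ⊆ ℂ²`: it is not
constant on `D`, and it is constant along the solutions in `D`, in real and in complex time.
(`D` is connected: otherwise a function taking a different constant value on each component
would count.) -/
structure IsFirstIntegralOn (P Q : ℂ[X][X]) (D : Set (ℂ × ℂ)) (I : ℂ × ℂ → ℂ) : Prop where
  isOpen : IsOpen D
  isConnected : IsConnected D
  nonconstant : ∃ p ∈ D, ∃ p' ∈ D, I p ≠ I p'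
  real_time : ConstantAlongSolutions ℝ P Q D I
  complex_time : ConstantAlongSolutions ℂ P Q D I

/-- `G` is a (single-valued) branch of the power `F ^ d`, `d ∈ ℂ`, on `D`: near each point of `D`
one has `G = exp (d * log F)` for a holomorphic branch `ℓ` of `log F`. -/
def IsPowerBranchOn (D : Set (ℂ × ℂ)) (F : ℂ[X][X]) (d : ℂ) (G : ℂ × ℂ → ℂ) : Prop :=
  ∀ p ∈ D, ∃ (U : Set (ℂ × ℂ)) (ℓ : ℂ × ℂ → ℂ), IsOpen U ∧ p ∈ U ∧ DifferentiableOn ℂ ℓ U ∧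
    ∀ p' ∈ U ∩ D, Complex.exp (ℓ p') = bival F p' ∧ G p' = Complex.exp (d * ℓ p')

/-- `I` is a Darboux function on `D`: `I = F₁ ^ d₁ ⋯ F_K ^ d_K * exp R` on `D`, with polynomials
`F_j ∈ ℂ[x, y]`, exponents `d_j ∈ ℂ`, and a rational function `R = A / B ∈ ℂ(x, y)` whose denominator
has no zero in `D`. -/
def IsDarbouxFunctionOn (D : Set (ℂ × ℂ)) (I : ℂ × ℂ → ℂ) : Prop :=
  ∃ (K : ℕ) (F : Fin K → ℂ[X][X]) (d : Fin K → ℂ) (G : Fin K → ℂ × ℂ → ℂ) (A B : ℂ[X][X]),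
    (∀ j, IsPowerBranchOn D (F j) (d j) (G j)) ∧
    (∀ p ∈ D, bival B p ≠ 0) ∧
    ∀ p ∈ D, I p = (∏ j, G j p) * Complex.exp (bival A p / bival B p)

/-- `I` is a Darboux first integral on `D`. -/
def IsDarbouxFirstIntegralOn (P Q : ℂ[X][X]) (D : Set (ℂ × ℂ)) (I : ℂ × ℂ → ℂ) : Prop :=
  IsFirstIntegralOn P Q D I ∧ IsDarbouxFunctionOn D I

/-- The polynomial system `x_t = P(x, y)`, `y_t = Q(x, y)` is Darboux integrable: it has a Darboux
first integral on some domain of `ℂ²`. -/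
def IsDarbouxIntegrable (P Q : ℂ[X][X]) : Prop :=
  ∃ (D : Set (ℂ × ℂ)) (I : ℂ × ℂ → ℂ), IsDarbouxFirstIntegralOn P Q D I

/-- The right-hand side of `x_t = y` for a Liénard system. -/
noncomputable def lienardP : ℂ[X][X] := X

/-- The right-hand side of `y_t = -f(x) y - g(x)` for the Liénard system of `f` and `g`. -/
noncomputable def lienardQ (f g : ℂ[X]) : ℂ[X][X] := -(C f * X) - C g

/-! Choose `q` with `q' = -f/2`. The system becomes `x' = y`, `y' = 2q'y - g`, and the condition on
the leading coefficients says exactly that `g - q'q` has degree at most `2m`.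

Integrability implies the form. For a Darboux function `I`, the form `dI/I` is rational and closed.
As `I` is a first integral, this form is a rational multiple `M` of `y dy - Q dx`, where `Q` is the
right-hand side of `y_t`, and closedness gives `L M = f M` for the derivative `L` along the flow.
Numerator and denominator of the reduced fraction `M` are then invariant, with cofactors differing
by `f = -2q'`.

The core is a description of all cofactors (`exists_cofactor_eq`). An invariant polynomial is, up to
a constant, monic in `y`, and its coefficients obey a recursion that must stop after the degree `n`
in `y`. Degree growth in `x` along the recursion shows that the mean of the `y`-roots is `q + t`
with `deg t ≤ m`; after shifting `y` by this mean, the same kind of growth forces the graph `y = q +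
t` to be invariant when `n > 0`. So the cofactor is `n(q' - t')`. The graph is unique, hence `i(q' -
t') - j(q' - u') = -2q'` gives `j = i + 2` and `u' = 0`. Then `g = q'(q + u)` with `u` constant, and
`q + u` is the required polynomial.

Conversely, `z = y - q` satisfies `z' = q'z` and `(q/z)' = q'`, so `log z - q/z` is constant along
solutions. -/

/-! ### Derivations on `ℂ[x][y]` and the derivative along a vector field. -/

/-- The partial derivative `∂/∂x` on `ℂ[x][y]`; the partial derivative `∂/∂y` is `derivative`. -/
noncomputable def xDeriv : Derivation ℂ ℂ[X][X] ℂ[X][X] :=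
  (PolynomialModule.equivPolynomialSelf (R := ℂ[X])).toLinearMap.compDer derivative'.mapCoeffs

theorem xDeriv_monomial (n : ℕ) (c : ℂ[X]) :
    xDeriv (monomial n c) = monomial n (derivative c) := by
  simp [xDeriv]

theorem xDeriv_C (c : ℂ[X]) : xDeriv (C c) = C (derivative c) := by
  simpa using xDeriv_monomial 0 c

theorem xDeriv_X : xDeriv (X : ℂ[X][X]) = 0 := by
  rw [← monomial_one_one_eq_X, xDeriv_monomial, derivative_one, map_zero]

theorem coeff_xDeriv (F : ℂ[X][X]) (n : ℕ) : (xDeriv F).coeff n = derivative (F.coeff n) := by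
  induction F using Polynomial.induction_on' with
  | add F G hF hG => simp [hF, hG]
  | monomial k c =>
    rw [xDeriv_monomial, coeff_monomial, coeff_monomial]
    split_ifs <;> simp

theorem xDeriv_mul (F G : ℂ[X][X]) : xDeriv (F * G) = F * xDeriv G + G * xDeriv F := by
  simp

theorem derivative_xDeriv (F : ℂ[X][X]) : derivative (xDeriv F) = xDeriv (derivative F) := by
  ext1 n
  simp [coeff_xDeriv, coeff_derivative]

/-- The derivative of `F` along the vector field `(P, Q)`. -/
noncomputable def lieDeriv (P Q F : ℂ[X][X]) : ℂ[X][X] := P * xDeriv F + Q * derivative F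

theorem lieDeriv_mul (P Q F G : ℂ[X][X]) :
    lieDeriv P Q (F * G) = F * lieDeriv P Q G + G * lieDeriv P Q F := by
  simp only [lieDeriv, xDeriv_mul, derivative_mul]
  ring

/-- The substitution `y ↦ y + s(x)` takes `y - s` as new coordinate, whose velocity is `Q - s'P`. It
moves the graph `y = s` to `y = 0`. -/
theorem lieDeriv_taylor (P Q F : ℂ[X][X]) (s : ℂ[X]) :
    taylor s (lieDeriv P Q F) =
      lieDeriv (taylor s P) (taylor s Q - C (derivative s) * taylor s P) (taylor s F) := by
  have hx : ∀ F : ℂ[X][X], xDeriv (taylor s F) =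
      taylor s (xDeriv F) + C (derivative s) * taylor s (derivative F) := by
    intro F
    induction F using Polynomial.induction_on' with
    | add F G hF hG => simp only [map_add, hF, hG]; ring
    | monomial k c =>
      rw [xDeriv_monomial, derivative_monomial, taylor_monomial, taylor_monomial, taylor_monomial,
        xDeriv_mul, Derivation.leibniz_pow, map_add, xDeriv_X, xDeriv_C, xDeriv_C]
      simp
      ring
  have hy : derivative (taylor s F) = taylor s (derivative F) := by
    simp [taylor_apply, derivative_comp]
  rw [lieDeriv, lieDeriv, hx, hy, map_add, taylor_mul, taylor_mul]
  ring

/-! ### Invariant polynomials from a rational integrating factor. -/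

theorem dvd_lieDeriv_of_isRelPrime {P Q A B k : ℂ[X][X]} (h : IsRelPrime A B)
    (hAB : lieDeriv P Q A * B - A * lieDeriv P Q B = k * A * B) :
    A ∣ lieDeriv P Q A ∧ B ∣ lieDeriv P Q B := by
  refine ⟨h.dvd_of_dvd_mul_right ⟨lieDeriv P Q B + k * B, ?_⟩,
    h.symm.dvd_of_dvd_mul_right ⟨lieDeriv P Q A - k * A, ?_⟩⟩
  · linear_combination hAB
  · linear_combination -hAB

/-- A rational solution `A / B` of `L(A / B) = k * (A / B)` yields two invariant curves whose
cofactors differ by `k`. -/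
theorem exists_invariant_pair {P Q A B k : ℂ[X][X]} (hA : A ≠ 0) (hB : B ≠ 0)
    (hAB : lieDeriv P Q A * B - A * lieDeriv P Q B = k * A * B) :
    ∃ A' B' c d : ℂ[X][X], A' ≠ 0 ∧ B' ≠ 0 ∧ lieDeriv P Q A' = c * A' ∧
      lieDeriv P Q B' = d * B' ∧ c - d = k := by
  obtain ⟨A', B', e, hrel, rfl, rfl⟩ := UniqueFactorizationMonoid.exists_reduced_factors A hA B
  have he : e ≠ 0 := left_ne_zero_of_mul hA
  have hA' : A' ≠ 0 := right_ne_zero_of_mul hA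
  have hB' : B' ≠ 0 := right_ne_zero_of_mul hB
  have h : lieDeriv P Q A' * B' - A' * lieDeriv P Q B' = k * A' * B' := by
    refine mul_left_cancel₀ (pow_ne_zero 2 he) ?_
    simp only [lieDeriv_mul] at hAB
    linear_combination hAB
  obtain ⟨⟨c, hc⟩, ⟨d, hd⟩⟩ := dvd_lieDeriv_of_isRelPrime hrel h
  refine ⟨A', B', c, d, hA', hB', by rw [hc, mul_comm], by rw [hd, mul_comm], ?_⟩
  refine mul_left_cancel₀ (mul_ne_zero hA' hB') ?_
  rw [hc, hd] at h
  linear_combination h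

/-! ### Degree growth in the recursion for the coefficients of an invariant polynomial. -/

/-- The `i`-th coefficient of `F` from the top, when `F` has degree `n`. -/
noncomputable def topCoeff (n : ℕ) (F : ℂ[X][X]) (i : ℕ) : ℂ[X] :=
  if i ≤ n then F.coeff (n - i) else 0

/-- The recursion satisfied by the coefficients, from the top, of a monic polynomial of degree `n`
in `y` that is invariant under `x' = y + p`, `y' = a * y - r`. -/
structure InvariantCoeffs (n : ℕ) (p a r : ℂ[X]) (G : ℕ → ℂ[X]) : Prop where
  zero : G 0 = 1
  vanish : G (n + 1) = 0
  one : ∀ i, i + 1 ≤ n → derivative (G (i + 2)) = derivative (G 1) * G (i + 1) +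
    C ((i : ℂ) + 1) * (a * G (i + 1)) - p * derivative (G (i + 1)) + C ((n : ℂ) - i) * (r * G i)

theorem coeff_lieDeriv_succ (p a r : ℂ[X]) (F : ℂ[X][X]) (k : ℕ) :
    (lieDeriv (X + C p) (C a * X - C r) F).coeff (k + 1) =
      derivative (F.coeff k) + p * derivative (F.coeff (k + 1)) +
        C ((k : ℂ) + 1) * (a * F.coeff (k + 1)) - C ((k : ℂ) + 2) * (r * F.coeff (k + 2)) := by
  simp only [lieDeriv, add_mul, sub_mul, coeff_add, coeff_sub, coeff_X_mul, coeff_C_mul, mul_assoc,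
    coeff_xDeriv, coeff_derivative]
  simp [map_ofNat C 2]
  ring

theorem coeff_lieDeriv_zero (p a r : ℂ[X]) (F : ℂ[X][X]) :
    (lieDeriv (X + C p) (C a * X - C r) F).coeff 0 =
      p * derivative (F.coeff 0) - r * F.coeff 1 := by
  simp only [lieDeriv, add_mul, sub_mul, coeff_add, coeff_sub, coeff_X_mul_zero, coeff_C_mul,
    mul_assoc, coeff_xDeriv, coeff_derivative]
  simp [sub_eq_add_neg]

/-- The coefficient of the highest power of `y` determines the cofactor; eliminating it from the
lower coefficients leaves a recursion in `p`, `a`, `r` alone. -/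
theorem invariantCoeffs_topCoeff {n : ℕ} {p a r l : ℂ[X]} {F : ℂ[X][X]} (hF : F.Monic)
    (hn : F.natDegree = n + 1) (hl : lieDeriv (X + C p) (C a * X - C r) F = C l * F) :
    l = derivative (topCoeff (n + 1) F 1) + C ((n : ℂ) + 1) * a ∧
      InvariantCoeffs (n + 1) p a r (topCoeff (n + 1) F) := by
  have h1 : F.coeff (n + 1) = 1 := by rw [← hn]; exact hF
  have h2 : F.coeff (n + 2) = 0 := coeff_eq_zero_of_natDegree_lt (by omega)
  have hk := fun k => congrArg (fun P => coeff P k) hl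
  simp only [coeff_C_mul] at hk
  have hl' : l = derivative (F.coeff n) + C ((n : ℂ) + 1) * a := by
    have := hk (n + 1)
    rw [coeff_lieDeriv_succ, h1, h2] at this
    simp at this ⊢
    linear_combination -this
  refine ⟨by simpa [topCoeff] using hl', by simp [topCoeff, h1], by simp [topCoeff], ?_⟩
  intro i hi
  obtain ⟨j, rfl⟩ : ∃ j, n = i + j := ⟨n - i, by omega⟩
  have e0 : topCoeff (i + j + 1) F 1 = F.coeff (i + j) := by simp [topCoeff]
  have e1 : topCoeff (i + j + 1) F (i + 1) = F.coeff j := by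
    rw [topCoeff, if_pos (by omega)]; congr 1; omega
  have e2 : topCoeff (i + j + 1) F i = F.coeff (j + 1) := by
    rw [topCoeff, if_pos (by omega)]; congr 1; omega
  rw [e0, e1, e2]
  -- For `j = 0` this is the equation at `y ^ 0`, which has no term from a lower power of `y`; the
  -- default value `0` of `topCoeff` stands for it.
  rcases j with _ | j
  · have e3 : topCoeff (i + 0 + 1) F (i + 2) = 0 := by rw [topCoeff, if_neg (by omega)]
    have := hk 0
    rw [coeff_lieDeriv_zero, hl'] at this
    rw [e3]
    simp at this ⊢
    linear_combination this
  · have e3 : topCoeff (i + (j + 1) + 1) F (i + 2) = F.coeff j := by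
      rw [topCoeff, if_pos (by omega)]; congr 1; omega
    have := hk (j + 1)
    rw [coeff_lieDeriv_succ, hl'] at this
    rw [e3]
    simp [map_ofNat C 2] at this ⊢
    linear_combination this

theorem natDegree_le_succ_of_derivative {G : ℂ[X]} {N : ℕ} (h : (derivative G).natDegree ≤ N) :
    G.natDegree ≤ N + 1 := by
  rw [natDegree_le_iff_coeff_eq_zero]
  intro k hk
  obtain ⟨k, rfl⟩ : ∃ j, k = j + 1 := ⟨k - 1, by omega⟩
  have := natDegree_le_iff_coeff_eq_zero.1 h k (by omega)
  rw [coeff_derivative] at this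
  exact (mul_eq_zero.1 this).resolve_right (by exact_mod_cast Nat.succ_ne_zero k)

theorem natDegree_derivative_le_of_le {G : ℂ[X]} {N : ℕ} (h : G.natDegree ≤ N + 1) :
    (derivative G).natDegree ≤ N :=
  (natDegree_derivative_le G).trans (by omega)

theorem coeff_eq_div_of_derivative (G : ℂ[X]) (N : ℕ) :
    G.coeff (N + 1) = (derivative G).coeff N / ((N : ℂ) + 1) := by
  rw [coeff_derivative, mul_div_cancel_right₀]
  exact_mod_cast Nat.succ_ne_zero N

/-- The subleading coefficient of an invariant polynomial has small degree. -/
theorem InvariantCoeffs.natDegree_one_le {n m : ℕ} {p a r : ℂ[X]} {G : ℕ → ℂ[X]}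
    (h : InvariantCoeffs n p a r G) (hp : p.natDegree ≤ m + 1) (ha : a.natDegree ≤ m)
    (hr : r.natDegree ≤ 2 * m) (hap : a.coeff m = ((m : ℂ) + 1) * p.coeff (m + 1)) :
    (G 1).natDegree ≤ m := by
  by_contra hcon
  obtain ⟨e, he⟩ : ∃ e, (G 1).natDegree = e + 1 := ⟨(G 1).natDegree - 1, by omega⟩
  have hme : m ≤ e := by omega
  have hap' : a.coeff e = ((e : ℂ) + 1) * p.coeff (e + 1) := by
    rcases hme.eq_or_lt with rfl | hlt
    · exact hap
    · rw [coeff_eq_zero_of_natDegree_lt (by omega), coeff_eq_zero_of_natDegree_lt (by omega),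
        mul_zero]
  have hc : (G 1).coeff (e + 1) ≠ 0 := by
    rw [← he]
    exact leadingCoeff_ne_zero.2 fun h0 => by simp [h0] at he
  have hG1 : (derivative (G 1)).natDegree ≤ e := natDegree_derivative_le_of_le he.le
  -- If `deg (G 1) = e + 1 > m`, then `G i` has degree exactly `i * (e + 1)`, so `G (n + 1)` cannot
  -- vanish.
  have key : ∀ i, i ≤ n → ((G i).natDegree ≤ i * (e + 1) ∧ (G i).coeff (i * (e + 1)) ≠ 0) ∧
      ((G (i + 1)).natDegree ≤ (i + 1) * (e + 1) ∧ (G (i + 1)).coeff ((i + 1) * (e + 1)) ≠ 0) := by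
    intro i
    induction i with
    | zero => intro _; simp [h.zero, he, hc]
    | succ i ih =>
      intro hi
      obtain ⟨⟨hd0, -⟩, hd1, hc1⟩ := ih (by omega)
      refine ⟨⟨hd1, hc1⟩, ?_⟩
      set N := i * (e + 1) + e with hN
      have hN1 : (i + 1) * (e + 1) = N + 1 := by rw [hN]; ring
      have hN2 : (i + 1 + 1) * (e + 1) = e + (N + 1) + 1 := by rw [hN]; ring
      rw [hN1] at hd1 hc1
      have hd1' : (derivative (G (i + 1))).natDegree ≤ N := natDegree_derivative_le_of_le hd1
      have hrG : (r * G i).natDegree < e + (N + 1) := by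
        refine natDegree_mul_le.trans_lt ?_
        omega
      have hdeg : (derivative (G (i + 2))).natDegree ≤ e + (N + 1) := by
        rw [h.one i hi]
        refine (natDegree_add_le_of_degree_le (natDegree_sub_le_of_le (natDegree_add_le_of_degree_le
          ?_ ?_) ?_ |>.trans_eq (max_self _)) ?_)
        · exact natDegree_mul_le_of_le hG1 hd1
        · exact (natDegree_C_mul_le _ _).trans (natDegree_mul_le_of_le (by omega) hd1)
        · exact (natDegree_mul_le_of_le hp hd1').trans (by omega)
        · exact (natDegree_C_mul_le _ _).trans hrG.le
      -- By `hap'` the contributions of `a` and `p` cancel at this degree and that of `r` is too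
      -- low; only `derivative (G 1)` contributes.
      have hcoeff : (derivative (G (i + 2))).coeff (e + (N + 1)) =
          ((e : ℂ) + 1) * (G 1).coeff (e + 1) * (G (i + 1)).coeff (N + 1) := by
        have c1 : (derivative (G 1) * G (i + 1)).coeff (e + (N + 1)) = _ :=
          coeff_mul_add_eq_of_natDegree_le hG1 hd1
        have c2 : (a * G (i + 1)).coeff (e + (N + 1)) = _ :=
          coeff_mul_add_eq_of_natDegree_le (by omega) hd1
        have c3 : (p * derivative (G (i + 1))).coeff ((e + 1) + N) = _ :=
          coeff_mul_add_eq_of_natDegree_le (by omega) hd1'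
        rw [show e + 1 + N = e + (N + 1) by ring] at c3
        rw [h.one i hi, coeff_add, coeff_sub, coeff_add, coeff_C_mul, coeff_C_mul, c1, c2, c3,
          coeff_eq_zero_of_natDegree_lt hrG, coeff_derivative, coeff_derivative, hap', hN]
        push_cast
        ring
      rw [hN2]
      refine ⟨natDegree_le_succ_of_derivative hdeg, ?_⟩
      rw [coeff_eq_div_of_derivative, hcoeff]
      refine div_ne_zero (mul_ne_zero (mul_ne_zero ?_ hc) hc1) ?_
      · exact_mod_cast Nat.succ_ne_zero e
      · exact Nat.cast_add_one_ne_zero _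
  have := (key n le_rfl).2.2
  simp [h.vanish] at this

/-- If the subleading coefficient of an invariant polynomial vanishes, then `y = 0` is invariant. -/
theorem InvariantCoeffs.eq_zero_of_one_eq_zero {n m : ℕ} {p a r : ℂ[X]} {G : ℕ → ℂ[X]}
    (h : InvariantCoeffs n p a r G) (hn : n ≠ 0) (h1 : G 1 = 0) (hp : p.natDegree ≤ m + 1)
    (hp0 : p.coeff (m + 1) ≠ 0) (ha : a.natDegree ≤ m) (hr : r.natDegree ≤ 2 * m)
    (hap : a.coeff m = ((m : ℂ) + 1) * p.coeff (m + 1)) : r = 0 := by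
  by_contra hr0
  set ρ := r.natDegree with hρ
  have hrρ : r.coeff ρ ≠ 0 := leadingCoeff_ne_zero.2 hr0
  have hn0 : (n : ℂ) ≠ 0 := by exact_mod_cast hn
  -- A nonzero `r` enters at `G 2`, and each later step raises the degree by exactly `m + 1`,
  -- contradicting `G (n + 1) = 0`. The alternative `G (j + 1) = 0` is needed because `natDegree 0 =
  -- 0` can violate the bound.
  have key : ∀ j, j + 1 ≤ n →
      (G (j + 1) = 0 ∨ (G (j + 1)).natDegree + m ≤ ρ + j * (m + 1)) ∧
      ((G (j + 2)).natDegree ≤ ρ + 1 + j * (m + 1) ∧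
        (G (j + 2)).coeff (ρ + 1 + j * (m + 1)) ≠ 0) := by
    intro j
    induction j with
    | zero =>
      intro hj
      have h2 : derivative (G 2) = C (n : ℂ) * r := by simpa [h1, h.zero] using h.one 0 hj
      refine ⟨Or.inl h1, ?_, ?_⟩
      · rw [zero_mul]
        exact natDegree_le_succ_of_derivative (h2 ▸ (natDegree_C_mul_le _ _))
      · rw [zero_mul, add_zero, coeff_eq_div_of_derivative, h2, coeff_C_mul]
        refine div_ne_zero (mul_ne_zero hn0 hrρ) ?_
        exact_mod_cast Nat.succ_ne_zero ρ
    | succ j ih =>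
      intro hj
      obtain ⟨hd0, hd1, hc1⟩ := ih (by omega)
      set N := ρ + j * (m + 1) with hN
      have e1 : ρ + 1 + j * (m + 1) = N + 1 := by rw [hN]; ring
      have e2 : ρ + (j + 1) * (m + 1) = m + (N + 1) := by rw [hN]; ring
      have e3 : ρ + 1 + (j + 1) * (m + 1) = m + (N + 1) + 1 := by rw [hN]; ring
      rw [e1] at hd1 hc1
      rw [e2, e3]
      have hd1' : (derivative (G (j + 2))).natDegree ≤ N := natDegree_derivative_le_of_le hd1
      refine ⟨Or.inr (by rw [show j + 1 + 1 = j + 2 by ring]; omega), ?_⟩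
      have hrG : (r * G (j + 1)).natDegree < m + (N + 1) := by
        rcases hd0 with hd0 | hd0
        · rw [hd0, mul_zero, natDegree_zero]; omega
        · refine natDegree_mul_le.trans_lt ?_
          omega
      have hrec := h.one (j + 1) hj
      rw [h1, derivative_zero, zero_mul, zero_add, show j + 1 + 1 = j + 2 by ring,
        show j + 1 + 2 = j + 3 by ring] at hrec
      rw [show j + 1 + 2 = j + 3 by ring]
      have hdeg : (derivative (G (j + 3))).natDegree ≤ m + (N + 1) := by
        rw [hrec]
        refine (natDegree_add_le_of_degree_le
          (natDegree_sub_le_of_le ?_ ?_ |>.trans_eq (max_self _)) ?_)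
        · exact (natDegree_C_mul_le _ _).trans (natDegree_mul_le_of_le ha hd1)
        · exact (natDegree_mul_le_of_le hp hd1').trans (by omega)
        · exact (natDegree_C_mul_le _ _).trans hrG.le
      -- The multiplier is `(j + 2)(m + 1) - (N + 1) = 2m + 1 - ρ`, positive because `ρ ≤ 2m`.
      have hcoeff : (derivative (G (j + 3))).coeff (m + (N + 1)) =
          ((2 * m + 1 - ρ : ℕ) : ℂ) * p.coeff (m + 1) * (G (j + 2)).coeff (N + 1) := by
        have c2 : (a * G (j + 2)).coeff (m + (N + 1)) = _ :=
          coeff_mul_add_eq_of_natDegree_le ha hd1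
        have c3 : (p * derivative (G (j + 2))).coeff ((m + 1) + N) = _ :=
          coeff_mul_add_eq_of_natDegree_le hp hd1'
        rw [show m + 1 + N = m + (N + 1) by ring] at c3
        rw [hrec, coeff_add, coeff_sub, coeff_C_mul, coeff_C_mul, c2, c3,
          coeff_eq_zero_of_natDegree_lt hrG, coeff_derivative, hap, hN,
          Nat.cast_sub (by omega)]
        push_cast
        ring
      refine ⟨natDegree_le_succ_of_derivative hdeg, ?_⟩
      rw [coeff_eq_div_of_derivative, hcoeff]
      refine div_ne_zero (mul_ne_zero (mul_ne_zero ?_ hp0) hc1) ?_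
      · exact_mod_cast (by omega : 2 * m + 1 - ρ ≠ 0)
      · exact Nat.cast_add_one_ne_zero _
  have := (key (n - 1) (by omega)).2.2
  rw [show n - 1 + 2 = n + 1 by omega] at this
  simp [h.vanish] at this

theorem lieDeriv_C_mul {P Q : ℂ[X][X]} (u : ℂ) (F : ℂ[X][X]) :
    lieDeriv P Q (C (C u) * F) = C (C u) * lieDeriv P Q F := by
  rw [lieDeriv_mul]
  simp [lieDeriv, xDeriv_C]

/-- The cofactor of an invariant polynomial does not depend on `y`, and the invariant polynomial is
monic in `y` up to a constant factor. -/
theorem cofactor_eq_C {p a r : ℂ[X]} {c F : ℂ[X][X]} (hF : F ≠ 0)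
    (h : lieDeriv (X + C p) (C a * X - C r) F = c * F) :
    ∃ (l : ℂ[X]) (u : ℂ), c = C l ∧ u ≠ 0 ∧ F.leadingCoeff = C u := by
  have hlc : F.coeff F.natDegree ≠ 0 := leadingCoeff_ne_zero.2 hF
  have hc : c.natDegree ≤ 1 := by
    rcases eq_or_ne c 0 with rfl | hc0
    · simp
    have h1 : (c * F).natDegree ≤ F.natDegree + 1 := by
      rw [← h, natDegree_le_iff_coeff_eq_zero]
      intro k hk
      obtain ⟨k, rfl⟩ : ∃ j, k = j + 1 := ⟨k - 1, by omega⟩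
      rw [coeff_lieDeriv_succ, coeff_eq_zero_of_natDegree_lt (show F.natDegree < k by omega),
        coeff_eq_zero_of_natDegree_lt (show F.natDegree < k + 1 by omega),
        coeff_eq_zero_of_natDegree_lt (show F.natDegree < k + 2 by omega)]
      simp
    rw [natDegree_mul hc0 hF] at h1
    omega
  obtain ⟨c1, c0, rfl⟩ := exists_eq_X_add_C_of_natDegree_le_one hc
  have h1 := congrArg (fun P => coeff P (F.natDegree + 1)) h
  simp only [coeff_lieDeriv_succ, add_mul, coeff_add, mul_assoc, coeff_C_mul, coeff_X_mul,
    coeff_eq_zero_of_natDegree_lt (show F.natDegree < F.natDegree + 1 by omega),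
    coeff_eq_zero_of_natDegree_lt (show F.natDegree < F.natDegree + 2 by omega),
    derivative_zero, mul_zero, add_zero, sub_zero] at h1
  -- The top equation reads `u' = c1 * u` for the leading coefficient `u`; degrees in `x` force `c1
  -- = 0`, so `u` is constant.
  have hc1 : c1 = 0 := by
    by_contra hc1
    have h2 := degree_derivative_lt hlc
    rw [h1, degree_mul] at h2
    exact absurd h2 (not_lt.2 (le_add_of_nonneg_left (zero_le_degree_iff.2 hc1)))
  rw [hc1, zero_mul] at h1
  refine ⟨c0, F.leadingCoeff.coeff 0, by simp [hc1], ?_, eq_C_of_derivative_eq_zero h1⟩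
  intro h0
  apply hlc
  exact (eq_C_of_derivative_eq_zero h1).trans ((congrArg C h0).trans C_0)

theorem coeff_taylor_of_natDegree_eq_succ {F : ℂ[X][X]} {n : ℕ} (hF : F.Monic)
    (hn : F.natDegree = n + 1) (t : ℂ[X]) :
    (taylor t F).coeff n = F.coeff n + C ((n : ℂ) + 1) * t := by
  have h1 : F.coeff (n + 1) = 1 := by rw [← hn]; exact hF
  have hd : (hasseDeriv n F).natDegree ≤ 1 := (natDegree_hasseDeriv_le F n).trans (by omega)
  rw [taylor_coeff, eval_eq_sum_range' (Nat.lt_succ_of_le hd), Finset.sum_range_succ,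
    Finset.sum_range_one, hasseDeriv_coeff, hasseDeriv_coeff, zero_add, add_comm 1 n, h1]
  simp

/-! ### Invariant graphs and cofactors of the Liénard system. -/

section Lienard

variable {m : ℕ} {q g : ℂ[X]}

theorem lieDeriv_taylor_lienard {l : ℂ[X]} {F : ℂ[X][X]}
    (h : lieDeriv (X + C 0) (C (2 * derivative q) * X - C g) F = C l * F) (t : ℂ[X]) :
    lieDeriv (X + C (q + t)) (C (derivative q - derivative t) * X -
      C (g - (derivative q - derivative t) * (q + t))) (taylor (q + t) F) =
      C l * taylor (q + t) F := by
  have := congrArg (taylor (q + t)) h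
  rw [lieDeriv_taylor, taylor_mul, taylor_C] at this
  have hP : taylor (q + t) (X + C 0 : ℂ[X][X]) = X + C (q + t) := by
    rw [C_0, add_zero, taylor_X]
  have hQ : taylor (q + t) (C (2 * derivative q) * X - C g) -
      C (derivative (q + t)) * (X + C (q + t)) = C (derivative q - derivative t) * X -
      C (g - (derivative q - derivative t) * (q + t)) := by
    rw [map_sub, taylor_mul, taylor_X, taylor_C, taylor_C, derivative_add, two_mul]
    simp only [C_add, C_sub, C_mul]
    ring
  rw [← this, hP, hQ]

theorem coeff_derivative_sub {t : ℂ[X]} (ht : t.natDegree ≤ m) :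
    (derivative q - derivative t).coeff m = ((m : ℂ) + 1) * (q + t).coeff (m + 1) := by
  rw [coeff_sub, coeff_derivative, coeff_derivative, coeff_add,
    coeff_eq_zero_of_natDegree_lt (show t.natDegree < m + 1 by omega)]
  ring

theorem natDegree_derivative_sub_le {t : ℂ[X]} (hq : q.natDegree ≤ m + 1) (ht : t.natDegree ≤ m) :
    (derivative q - derivative t).natDegree ≤ m :=
  (natDegree_sub_le_of_le (natDegree_derivative_le_of_le hq)
    (natDegree_derivative_le_of_le (by omega))).trans_eq (max_self m)

theorem natDegree_add_le_succ {t : ℂ[X]} (hq : q.natDegree ≤ m + 1) (ht : t.natDegree ≤ m) :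
    (q + t).natDegree ≤ m + 1 :=
  natDegree_add_le_of_degree_le hq (by omega)

/-- For `m = 0` the generic bound on `derivative t * (q + t)` is one too large, so `t' = 0` is used
directly. -/
theorem natDegree_residual_le {t : ℂ[X]} (hq : q.natDegree ≤ m + 1)
    (hg : (g - derivative q * q).natDegree ≤ 2 * m) (ht : t.natDegree ≤ m) :
    (g - (derivative q - derivative t) * (q + t)).natDegree ≤ 2 * m := by
  rcases m with _ | m
  · obtain ⟨c, rfl⟩ := natDegree_eq_zero.1 (Nat.le_zero.1 ht)
    rw [show g - (derivative q - derivative (C c)) * (q + C c) =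
      (g - derivative q * q) - derivative q * C c by rw [derivative_C]; ring]
    refine (natDegree_sub_le_of_le hg (natDegree_mul_le_of_le (n := 0)
      (natDegree_derivative_le_of_le hq) (natDegree_C c).le)).trans ?_
    simp
  · rw [show g - (derivative q - derivative t) * (q + t) = (g - derivative q * q) -
      (derivative q * t - derivative t * (q + t)) by ring]
    refine (natDegree_sub_le_of_le hg (natDegree_sub_le_of_le
      (natDegree_mul_le_of_le (natDegree_derivative_le_of_le hq) ht)
      (natDegree_mul_le_of_le (natDegree_derivative_le_of_le ht)
        (natDegree_add_le_succ hq ht)))).trans ?_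
    simp
    omega

/-- A monic invariant polynomial of positive degree in `y` forces an invariant graph
`y = q(x) + t(x)` with `deg t ≤ m`. -/
theorem exists_graph_of_invariant (hq : q.natDegree ≤ m + 1) (hq0 : q.coeff (m + 1) ≠ 0)
    (hg : (g - derivative q * q).natDegree ≤ 2 * m) {n : ℕ} {l : ℂ[X]} {F : ℂ[X][X]}
    (hF : F.Monic) (hn : F.natDegree = n + 1)
    (h : lieDeriv (X + C 0) (C (2 * derivative q) * X - C g) F = C l * F) :
    ∃ t : ℂ[X], t.natDegree ≤ m ∧ g = (derivative q - derivative t) * (q + t) ∧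
      l = C ((n : ℂ) + 1) * (derivative q - derivative t) := by
  have hmonic : ∀ s : ℂ[X], (taylor s F).Monic := fun s => by
    rw [Monic, leadingCoeff_taylor]; exact hF
  have hdeg : ∀ s : ℂ[X], (taylor s F).natDegree = n + 1 := fun s => by
    rw [natDegree_taylor, hn]
  have h0 := lieDeriv_taylor_lienard h 0
  rw [derivative_zero, sub_zero, add_zero] at h0
  have hd := (invariantCoeffs_topCoeff (hmonic q) (hdeg q) h0).2.natDegree_one_le hq
    (natDegree_derivative_le_of_le hq) hg (by rw [coeff_derivative, mul_comm])
  set G := topCoeff (n + 1) (taylor q F) 1 with hG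
  have hn0 : (n : ℂ) + 1 ≠ 0 := Nat.cast_add_one_ne_zero n
  -- This shift is the mean of the `y`-roots of `taylor q F`, so it removes the subleading
  -- coefficient.
  set t : ℂ[X] := -(C ((n : ℂ) + 1)⁻¹ * G) with ht
  have htd : t.natDegree ≤ m := by
    rw [ht, natDegree_neg]
    exact (natDegree_C_mul_le _ _).trans hd
  obtain ⟨hl, hI⟩ := invariantCoeffs_topCoeff (hmonic (q + t)) (hdeg (q + t))
    (lieDeriv_taylor_lienard h t)
  have hG1 : topCoeff (n + 1) (taylor (q + t) F) 1 = 0 := by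
    have : taylor (q + t) F = taylor t (taylor q F) := by rw [taylor_taylor, add_comm]
    rw [topCoeff, if_pos (by omega), Nat.add_sub_cancel, this,
      coeff_taylor_of_natDegree_eq_succ (hmonic q) (hdeg q), ht, hG, topCoeff, if_pos (by omega),
      Nat.add_sub_cancel, mul_neg, ← mul_assoc, ← C_mul, mul_inv_cancel₀ hn0]
    simp
  refine ⟨t, htd, ?_, by simpa [hG1] using hl⟩
  refine sub_eq_zero.1 (hI.eq_zero_of_one_eq_zero (Nat.succ_ne_zero n) hG1
    (natDegree_add_le_succ hq htd) ?_ (natDegree_derivative_sub_le hq htd)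
    (natDegree_residual_le hq hg htd) (coeff_derivative_sub htd))
  rw [coeff_add, coeff_eq_zero_of_natDegree_lt (show t.natDegree < m + 1 by omega), add_zero]
  exact hq0

/-- The invariant graph `y = q(x) + t(x)` with `deg t ≤ m` is unique. -/
theorem graph_unique (hq : q.natDegree ≤ m + 1) (hq0 : q.coeff (m + 1) ≠ 0) {t u : ℂ[X]}
    (ht : t.natDegree ≤ m) (hu : u.natDegree ≤ m)
    (h : (derivative q - derivative t) * (q + t) = (derivative q - derivative u) * (q + u)) :
    t = u := by
  by_contra hne
  set d := t - u with hd
  have hd0 : d ≠ 0 := sub_ne_zero.2 hne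
  set k := d.natDegree with hk
  have hkm : k ≤ m := (natDegree_sub_le_of_le ht hu).trans (by simp)
  have hlc : d.coeff k ≠ 0 := leadingCoeff_ne_zero.2 hd0
  have hid : (derivative q - derivative t) * d = (q + u) * derivative d := by
    rw [hd, derivative_sub]
    linear_combination h
  have hdq := coeff_derivative_sub (q := q) ht
  have htq : ∀ {v : ℂ[X]}, v.natDegree ≤ m → (q + v).coeff (m + 1) = q.coeff (m + 1) := by
    intro v hv
    rw [coeff_add, coeff_eq_zero_of_natDegree_lt (show v.natDegree < m + 1 by omega), add_zero]
  have h1 : ((derivative q - derivative t) * d).coeff (m + k) = _ :=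
    coeff_mul_add_eq_of_natDegree_le (natDegree_derivative_sub_le hq ht) hk.le
  have h2 : ((q + u) * derivative d).coeff (m + k) = (k : ℂ) * q.coeff (m + 1) * d.coeff k := by
    rcases hk' : k with _ | j
    · rw [derivative_of_natDegree_zero (hk.symm.trans hk')]
      simp
    · have := coeff_mul_add_eq_of_natDegree_le (natDegree_add_le_succ hq hu)
        (natDegree_derivative_le_of_le (hk.symm.trans hk').le)
      rw [show m + (j + 1) = m + 1 + j by ring, this, coeff_derivative, htq hu]
      push_cast
      ring
  rw [hdq, htq ht, hid, h2] at h1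
  -- Leading terms of `(q' - t') d = (q + u) d'` would require `m + 1 = k`, while `k ≤ m`.
  have h3 : ((m + 1 - k : ℕ) : ℂ) * q.coeff (m + 1) * d.coeff k = 0 := by
    rw [Nat.cast_sub (by omega)]
    push_cast
    linear_combination -h1
  refine mul_ne_zero (mul_ne_zero ?_ hq0) hlc h3
  exact_mod_cast (by omega : m + 1 - k ≠ 0)

/-- Every invariant polynomial has cofactor `n * (q' - t')`, and an invariant graph exists unless
`n = 0`. -/
theorem exists_cofactor_eq (hq : q.natDegree ≤ m + 1) (hq0 : q.coeff (m + 1) ≠ 0)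
    (hg : (g - derivative q * q).natDegree ≤ 2 * m) {c F : ℂ[X][X]} (hF : F ≠ 0)
    (h : lieDeriv (X + C 0) (C (2 * derivative q) * X - C g) F = c * F) :
    ∃ (n : ℕ) (t : ℂ[X]), t.natDegree ≤ m ∧
      (n ≠ 0 → g = (derivative q - derivative t) * (q + t)) ∧
      c = C (C (n : ℂ) * (derivative q - derivative t)) := by
  obtain ⟨l, u, rfl, hu, hlc⟩ := cofactor_eq_C hF h
  set F₁ := C (C u⁻¹) * F with hF₁
  have hmonic : F₁.Monic := by
    rw [Monic, hF₁, leadingCoeff_mul, leadingCoeff_C, hlc, ← C_mul, inv_mul_cancel₀ hu, C_1]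
  have h₁ : lieDeriv (X + C 0) (C (2 * derivative q) * X - C g) F₁ = C l * F₁ := by
    rw [hF₁, lieDeriv_C_mul, h]
    ring
  rcases hn : F₁.natDegree with _ | n
  · refine ⟨0, 0, by simp, by simp, ?_⟩
    rw [eq_one_of_monic_natDegree_zero hmonic hn] at h₁
    have h₂ : lieDeriv (X + C 0) (C (2 * derivative q) * X - C g) 1 = 0 := by simp [lieDeriv]
    rw [h₂, mul_one] at h₁
    simp [← h₁]
  · obtain ⟨t, ht, hgt, hl⟩ := exists_graph_of_invariant hq hq0 hg hmonic hn h₁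
    exact ⟨n + 1, t, ht, fun _ => hgt, by rw [hl]; push_cast; rfl⟩

/-- A rational integrating factor forces the integrable form of the system. -/
theorem exists_integrable_form (hq : q.natDegree ≤ m + 1) (hq0 : q.coeff (m + 1) ≠ 0)
    (hg : (g - derivative q * q).natDegree ≤ 2 * m) {A B : ℂ[X][X]} (hA : A ≠ 0) (hB : B ≠ 0)
    (hAB : lieDeriv (X + C 0) (C (2 * derivative q) * X - C g) A * B -
      A * lieDeriv (X + C 0) (C (2 * derivative q) * X - C g) B =
      C (-(2 * derivative q)) * A * B) :
    ∃ t : ℂ[X], t.natDegree ≤ m ∧ derivative t = 0 ∧ g = derivative q * (q + t) := by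
  obtain ⟨A', B', c, d, hA', hB', hc, hd, hcd⟩ := exists_invariant_pair hA hB hAB
  obtain ⟨i, t, ht, hgt, rfl⟩ := exists_cofactor_eq hq hq0 hg hA' hc
  obtain ⟨j, u, hu, hgu, rfl⟩ := exists_cofactor_eq hq hq0 hg hB' hd
  rw [← C_sub, C_inj] at hcd
  -- Compare coefficients of `x ^ m`, which `t'` and `u'` do not reach. In particular `j ≠ 0`, so
  -- the graph of `u` is invariant.
  have hij : i + 2 = j := by
    have h1 := congrArg (fun P => coeff P m) hcd
    simp only [coeff_sub, coeff_C_mul, coeff_neg, ← map_ofNat (C : ℂ →+* ℂ[X]) 2] at h1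
    rw [← coeff_sub, ← coeff_sub, coeff_derivative_sub ht, coeff_derivative_sub hu, coeff_add,
      coeff_add, coeff_derivative,
      coeff_eq_zero_of_natDegree_lt (show t.natDegree < m + 1 by omega),
      coeff_eq_zero_of_natDegree_lt (show u.natDegree < m + 1 by omega)] at h1
    have h2 : ((i : ℂ) + 2) * (((m : ℂ) + 1) * q.coeff (m + 1)) =
        (j : ℂ) * (((m : ℂ) + 1) * q.coeff (m + 1)) := by linear_combination h1
    exact_mod_cast mul_right_cancel₀ (mul_ne_zero (Nat.cast_add_one_ne_zero m) hq0) h2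
  have hgu' := hgu (by omega)
  have hiu : C (i : ℂ) * derivative t = C (i : ℂ) * derivative u := by
    rcases eq_or_ne i 0 with rfl | hi
    · simp
    · rw [graph_unique hq hq0 ht hu ((hgt hi).symm.trans hgu')]
  have hu0 : derivative u = 0 := by
    rw [← hij] at hcd
    push_cast at hcd
    rw [C_add, map_ofNat C 2] at hcd
    have : (2 : ℂ[X]) * derivative u = 0 := by linear_combination hcd + hiu
    exact (mul_eq_zero.1 this).resolve_left two_ne_zero
  exact ⟨u, hu, hu0, by simpa [hu0] using hgu'⟩

end Lienard

/-! ### Evaluation of polynomials on `ℂ²`. -/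

theorem bival_add (F G : ℂ[X][X]) (p : ℂ × ℂ) : bival (F + G) p = bival F p + bival G p :=
  evalEval_add ..

theorem bival_sub (F G : ℂ[X][X]) (p : ℂ × ℂ) : bival (F - G) p = bival F p - bival G p :=
  evalEval_sub ..

theorem bival_mul (F G : ℂ[X][X]) (p : ℂ × ℂ) : bival (F * G) p = bival F p * bival G p :=
  evalEval_mul ..

theorem bival_neg (F : ℂ[X][X]) (p : ℂ × ℂ) : bival (-F) p = -bival F p :=
  evalEval_neg ..

theorem bival_C (c : ℂ[X]) (p : ℂ × ℂ) : bival (C c) p = c.eval p.1 :=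
  evalEval_C ..

theorem bival_X (p : ℂ × ℂ) : bival X p = p.2 :=
  evalEval_X ..

theorem bival_zero (p : ℂ × ℂ) : bival 0 p = 0 :=
  evalEval_zero ..

theorem bival_one (p : ℂ × ℂ) : bival 1 p = 1 :=
  evalEval_one ..

theorem bival_monomial (n : ℕ) (c : ℂ[X]) (p : ℂ × ℂ) :
    bival (monomial n c) p = c.eval p.1 * p.2 ^ n := by
  rw [← C_mul_X_pow_eq_monomial, bival_mul, bival_C, bival, evalEval_pow, evalEval_X]

theorem contDiff_bival (F : ℂ[X][X]) : ContDiff ℂ 1 (bival F) := by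
  induction F using Polynomial.induction_on' with
  | add F G hF hG => simpa only [← bival_add] using hF.add hG
  | monomial n c =>
    rw [show bival (monomial n c) = _ from funext fun p => bival_monomial n c p]
    exact ((by simpa using c.contDiff_aeval (𝕜 := ℂ) 1 :
      ContDiff ℂ 1 fun x => c.eval x).comp contDiff_fst).mul (contDiff_snd.pow n)

theorem hasFDerivAt_bival (F : ℂ[X][X]) (p : ℂ × ℂ) :
    HasFDerivAt (bival F) (bival (xDeriv F) p • ContinuousLinearMap.fst ℂ ℂ ℂ +
      bival (derivative F) p • ContinuousLinearMap.snd ℂ ℂ ℂ) p := by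
  induction F using Polynomial.induction_on' with
  | add F G hF hG =>
    have := hF.add hG
    rw [show bival (F + G) = bival F + bival G from funext fun p => bival_add F G p]
    refine this.congr_fderiv ?_
    rw [map_add, derivative_add, bival_add, bival_add]
    module
  | monomial n c =>
    rw [show bival (monomial n c) = _ from funext fun p => bival_monomial n c p,
      xDeriv_monomial, derivative_monomial, bival_monomial, bival_monomial]
    have h1 := (c.hasDerivAt p.1).comp_hasFDerivAt p (hasFDerivAt_fst (𝕜 := ℂ) (F := ℂ))
    have h2 : HasFDerivAt (fun p : ℂ × ℂ => p.2 ^ n) _ p :=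
      (hasDerivAt_pow n p.2).comp_hasFDerivAt p (hasFDerivAt_snd (𝕜 := ℂ) (E := ℂ))
    refine (h1.mul h2).congr_fderiv ?_
    ext <;> simp <;> ring

theorem eq_zero_of_bival_eq_zero {F : ℂ[X][X]} {D : Set (ℂ × ℂ)} (hD : IsOpen D)
    (hne : D.Nonempty) (h : ∀ p ∈ D, bival F p = 0) : F = 0 := by
  obtain ⟨p, hp⟩ := hne
  obtain ⟨S, T, hS, hT, hpS, hpT, hST⟩ := isOpen_prod_iff.1 hD p.1 p.2 hp
  have hSi : S.Infinite := infinite_of_mem_nhds p.1 (hS.mem_nhds hpS)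
  have hTi : T.Infinite := infinite_of_mem_nhds p.2 (hT.mem_nhds hpT)
  refine eq_zero_of_infinite_isRoot F ((hTi.image C_injective.injOn).mono ?_)
  rintro _ ⟨y, hy, rfl⟩
  exact eq_zero_of_infinite_isRoot _ (hSi.mono fun x hx => h (x, y) (hST ⟨hx, hy⟩))

/-! ### Closed rational logarithmic forms of Darboux functions. -/

/-- On `D`, the logarithmic differential of `I` is the rational one-form `(U dx + V dy) / H`, and
this form is closed. -/
structure HasClosedLogForm (D : Set (ℂ × ℂ)) (I : ℂ × ℂ → ℂ) (U V H : ℂ[X][X]) : Prop where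
  closed : derivative U * H - U * derivative H = xDeriv V * H - V * xDeriv H
  denom_ne_zero : ∀ p ∈ D, bival H p ≠ 0
  ne_zero : ∀ p ∈ D, I p ≠ 0
  hasFDerivAt : ∀ p ∈ D, HasFDerivAt I (I p •
    ((bival U p / bival H p) • ContinuousLinearMap.fst ℂ ℂ ℂ +
      (bival V p / bival H p) • ContinuousLinearMap.snd ℂ ℂ ℂ)) p

namespace HasClosedLogForm

variable {D : Set (ℂ × ℂ)}

theorem one : HasClosedLogForm D (fun _ => 1) 0 0 1 where
  closed := by simp
  denom_ne_zero p _ := by simp [bival_one]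
  ne_zero p _ := one_ne_zero
  hasFDerivAt p _ := (hasFDerivAt_const (1 : ℂ) p).congr_fderiv (by ext <;> simp [bival_zero])

theorem mul {I₁ I₂ : ℂ × ℂ → ℂ} {U₁ V₁ H₁ U₂ V₂ H₂ : ℂ[X][X]} (h₁ : HasClosedLogForm D I₁ U₁ V₁ H₁)
    (h₂ : HasClosedLogForm D I₂ U₂ V₂ H₂) :
    HasClosedLogForm D (fun p => I₁ p * I₂ p) (U₁ * H₂ + U₂ * H₁) (V₁ * H₂ + V₂ * H₁)
      (H₁ * H₂) where
  closed := by
    simp only [map_add, derivative_mul, xDeriv_mul]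
    linear_combination H₂ ^ 2 * h₁.closed + H₁ ^ 2 * h₂.closed
  denom_ne_zero p hp := by
    rw [bival_mul]
    exact mul_ne_zero (h₁.denom_ne_zero p hp) (h₂.denom_ne_zero p hp)
  ne_zero p hp := mul_ne_zero (h₁.ne_zero p hp) (h₂.ne_zero p hp)
  hasFDerivAt p hp := by
    have := h₁.denom_ne_zero p hp
    have := h₂.denom_ne_zero p hp
    refine ((h₁.hasFDerivAt p hp).mul (h₂.hasFDerivAt p hp)).congr_fderiv ?_
    ext <;> simp [bival_add, bival_mul] <;> field_simp <;> ring

theorem exp_div (A B : ℂ[X][X]) (hB : ∀ p ∈ D, bival B p ≠ 0) :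
    HasClosedLogForm D (fun p => Complex.exp (bival A p / bival B p))
      (xDeriv A * B - A * xDeriv B) (derivative A * B - A * derivative B) (B * B) where
  closed := by
    simp only [map_sub, derivative_mul, xDeriv_mul, derivative_xDeriv]
    ring
  denom_ne_zero p hp := by
    rw [bival_mul]
    exact mul_ne_zero (hB p hp) (hB p hp)
  ne_zero p _ := Complex.exp_ne_zero _
  hasFDerivAt p hp := by
    have hBp := hB p hp
    have hinv := (hasDerivAt_inv hBp).comp_hasFDerivAt p (hasFDerivAt_bival B p)
    have h := ((hasFDerivAt_bival A p).mul hinv).cexp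
    simp only [Function.comp_apply] at h
    refine h.congr_fderiv ?_
    ext <;> simp [bival_sub, bival_mul] <;> field_simp <;> ring

theorem of_isPowerBranchOn {F : ℂ[X][X]} {d : ℂ} {G : ℂ × ℂ → ℂ} (hD : IsOpen D)
    (hG : IsPowerBranchOn D F d G) :
    HasClosedLogForm D G (C (C d) * xDeriv F) (C (C d) * derivative F) F where
  closed := by
    simp only [derivative_mul, xDeriv_mul, derivative_xDeriv, xDeriv_C, derivative_C, map_zero]
    ring
  denom_ne_zero p hp := by
    obtain ⟨W, l, -, hpW, -, h⟩ := hG p hp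
    rw [← (h p ⟨hpW, hp⟩).1]
    exact Complex.exp_ne_zero _
  ne_zero p hp := by
    obtain ⟨W, l, -, hpW, -, h⟩ := hG p hp
    rw [(h p ⟨hpW, hp⟩).2]
    exact Complex.exp_ne_zero _
  hasFDerivAt p hp := by
    obtain ⟨W, l, hW, hpW, hl, h⟩ := hG p hp
    have hmem : W ∩ D ∈ nhds p := (hW.inter hD).mem_nhds ⟨hpW, hp⟩
    have hl' := (hl.differentiableAt (hW.mem_nhds hpW)).hasFDerivAt
    have hF : HasFDerivAt (bival F) (Complex.exp (l p) • fderiv ℂ l p) p :=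
      hl'.cexp.congr_of_eventuallyEq
        (Filter.eventually_of_mem hmem fun p' hp' => (h p' hp').1.symm)
    have heq := hF.unique (hasFDerivAt_bival F p)
    have hGd : HasFDerivAt G (Complex.exp (d * l p) • d • fderiv ℂ l p) p :=
      (hl'.const_mul d).cexp.congr_of_eventuallyEq
        (Filter.eventually_of_mem hmem fun p' hp' => (h p' hp').2)
    refine hGd.congr_fderiv ?_
    obtain ⟨hFp, hGp⟩ := h p ⟨hpW, hp⟩
    have hne : bival F p ≠ 0 := hFp ▸ Complex.exp_ne_zero _
    have hl2 : fderiv ℂ l p = (bival F p)⁻¹ •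
        (bival (xDeriv F) p • ContinuousLinearMap.fst ℂ ℂ ℂ +
          bival (derivative F) p • ContinuousLinearMap.snd ℂ ℂ ℂ) := by
      rw [← heq, ← hFp, smul_smul, inv_mul_cancel₀ (Complex.exp_ne_zero _), one_smul]
    rw [hl2, hGp]
    ext <;> simp [bival_mul, bival_C] <;> field_simp

theorem congr {I J : ℂ × ℂ → ℂ} {U V H : ℂ[X][X]} (hD : IsOpen D) (h : HasClosedLogForm D I U V H)
    (hIJ : ∀ p ∈ D, J p = I p) : HasClosedLogForm D J U V H where
  closed := h.closed
  denom_ne_zero := h.denom_ne_zero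
  ne_zero p hp := hIJ p hp ▸ h.ne_zero p hp
  hasFDerivAt p hp := by
    rw [hIJ p hp]
    exact (h.hasFDerivAt p hp).congr_of_eventuallyEq
      (Filter.eventually_of_mem (hD.mem_nhds hp) hIJ)

theorem exists_prod {K : ℕ} (I : Fin K → ℂ × ℂ → ℂ)
    (h : ∀ j, ∃ U V H, HasClosedLogForm D (I j) U V H) :
    ∃ U V H, HasClosedLogForm D (fun p => ∏ j, I j p) U V H := by
  induction K with
  | zero => exact ⟨0, 0, 1, by simpa using one⟩
  | succ K ih =>
    obtain ⟨U₁, V₁, H₁, h₁⟩ := h 0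
    obtain ⟨U₂, V₂, H₂, h₂⟩ := ih (fun j => I j.succ) fun j => h j.succ
    exact ⟨_, _, _, by simpa only [Fin.prod_univ_succ] using h₁.mul h₂⟩

end HasClosedLogForm

theorem IsDarbouxFunctionOn.exists_hasClosedLogForm {D : Set (ℂ × ℂ)} {I : ℂ × ℂ → ℂ}
    (hD : IsOpen D) (h : IsDarbouxFunctionOn D I) : ∃ U V H, HasClosedLogForm D I U V H := by
  obtain ⟨K, F, d, G, A, B, hG, hB, hI⟩ := h
  obtain ⟨U, V, H, hUVH⟩ := HasClosedLogForm.exists_prod G fun j =>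
    ⟨_, _, _, HasClosedLogForm.of_isPowerBranchOn hD (hG j)⟩
  exact ⟨_, _, _, (hUVH.mul (HasClosedLogForm.exp_div A B hB)).congr hD hI⟩

/-! ### From a first integral to an integrating factor. -/

/-- A function that is constant along real-time solutions is annihilated by the vector field. -/
theorem fderiv_apply_eq_zero_of_constantAlongSolutions {P Q : ℂ[X][X]} {D : Set (ℂ × ℂ)}
    {I : ℂ × ℂ → ℂ} (hD : IsOpen D) (hI : ConstantAlongSolutions ℝ P Q D I) {p : ℂ × ℂ}
    (hp : p ∈ D) {I' : ℂ × ℂ →L[ℂ] ℂ} (hI' : HasFDerivAt I I' p) :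
    I' (bival P p, bival Q p) = 0 := by
  -- Picard–Lindelöf supplies a real-time solution through `p`, along which `I` has derivative zero.
  have hv : ContDiffAt ℝ 1 (fun p : ℂ × ℂ => (bival P p, bival Q p)) p :=
    (((contDiff_bival P).prodMk (contDiff_bival Q)).restrict_scalars ℝ).contDiffAt
  obtain ⟨α, hα0, ε, hε, hα⟩ :=
    hv.exists_forall_mem_closedBall_exists_eq_forall_mem_Ioo_hasDerivAt₀ 0
  have h0 : HasDerivAt α (bival P p, bival Q p) 0 := by
    have := hα 0 (by simp [hε])
    rwa [hα0] at this
  have hnear : ∀ᶠ t in nhds (0 : ℝ), α t ∈ D ∧ t ∈ Set.Ioo (0 - ε) (0 + ε) :=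
    (h0.continuousAt.eventually (hα0.symm ▸ hD.mem_nhds hp)).and
      (Ioo_mem_nhds (by linarith) (by linarith))
  obtain ⟨δ, hδ, hball⟩ := Metric.eventually_nhds_iff_ball.1 hnear
  have hconst : ∀ t ∈ Metric.ball (0 : ℝ) δ, I (α t) = I (α 0) := fun t ht =>
    hI _ α Metric.isOpen_ball (convex_ball 0 δ).isPreconnected (fun s hs => hα s (hball s hs).2)
      (fun s hs => (hball s hs).1) t ht 0 (Metric.mem_ball_self hδ)
  have hI0 : HasFDerivAt I (I'.restrictScalars ℝ) (α 0) := hα0.symm ▸ hI'.restrictScalars ℝ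
  have h1 : HasDerivAt (I ∘ α) (I' (bival P p, bival Q p)) 0 := hI0.comp_hasDerivAt 0 h0
  have h2 : HasDerivAt (I ∘ α) 0 0 := (hasDerivAt_const (0 : ℝ) (I (α 0))).congr_of_eventuallyEq
    (Filter.eventually_of_mem (Metric.ball_mem_nhds 0 hδ) hconst)
  exact h1.unique h2

/-- A Darboux first integral yields a rational integrating factor `A / B`. -/
theorem IsDarbouxIntegrable.exists_integrating_factor {f g : ℂ[X]}
    (h : IsDarbouxIntegrable lienardP (lienardQ f g)) :
    ∃ A B : ℂ[X][X], A ≠ 0 ∧ B ≠ 0 ∧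
      lieDeriv lienardP (lienardQ f g) A * B - A * lieDeriv lienardP (lienardQ f g) B =
        C f * A * B := by
  obtain ⟨D, I, hI, hdar⟩ := h
  have hne := hI.isConnected.nonempty
  obtain ⟨U, V, H, hUVH⟩ := hdar.exists_hasClosedLogForm hI.isOpen
  have hH : H ≠ 0 := by
    rintro rfl
    obtain ⟨p, hp⟩ := hne
    exact hUVH.denom_ne_zero p hp (bival_zero p)
  have hrel : U * X + V * lienardQ f g = 0 := by
    refine eq_zero_of_bival_eq_zero hI.isOpen hne fun p hp => ?_
    have h1 := fderiv_apply_eq_zero_of_constantAlongSolutions hI.isOpen hI.real_time hp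
      (hUVH.hasFDerivAt p hp)
    have h2 := hUVH.denom_ne_zero p hp
    have h3 := hUVH.ne_zero p hp
    have h4 : bival U p / bival H p * p.2 +
        bival V p / bival H p * bival (lienardQ f g) p = 0 := by
      refine (mul_eq_zero.1 ?_).resolve_left h3
      rw [mul_add]
      simpa [lienardP, bival_X] using h1
    field_simp at h4
    rw [bival_add, bival_mul, bival_mul, bival_X]
    linear_combination h4
  have hV : V ≠ 0 := by
    rintro rfl
    have hU : U = 0 := by simpa using hrel
    subst hU
    obtain ⟨p, hp, p', hp', hpp⟩ := hI.nonconstant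
    refine hpp (hI.isOpen.is_const_of_fderiv_eq_zero hI.isConnected.isPreconnected (𝕜 := ℂ)
      (fun z hz => (hUVH.hasFDerivAt z hz).differentiableAt.differentiableWithinAt)
      (fun z hz => ?_) hp hp')
    rw [(hUVH.hasFDerivAt z hz).fderiv]
    ext <;> simp [bival_zero]
  -- Since `U y + V Q = 0`, the logarithmic form is `(V / (y H)) (y dy - Q dx)`.
  refine ⟨V, X * H, hV, mul_ne_zero X_ne_zero hH, ?_⟩
  have hder := congrArg derivative hrel
  have hQ : derivative (lienardQ f g) = -C f := by simp [lienardQ]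
  simp only [derivative_add, derivative_mul, derivative_X, derivative_zero, hQ] at hder
  have hcl := hUVH.closed
  simp only [lieDeriv, lienardP, derivative_mul, xDeriv_mul, xDeriv_X, derivative_X]
  linear_combination -X ^ 2 * hcl + X * H * hder - (X * derivative H + H) * hrel

/-! ### The explicit first integral and the equivalence. -/

theorem exists_derivative_eq (f : ℂ[X]) : ∃ q : ℂ[X], derivative q = f := by
  induction f using Polynomial.induction_on' with
  | add f g hf hg =>
    obtain ⟨a, rfl⟩ := hf
    obtain ⟨b, rfl⟩ := hg
    exact ⟨a + b, derivative_add⟩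
  | monomial n c =>
    refine ⟨monomial (n + 1) (c / ((n : ℂ) + 1)), ?_⟩
    rw [derivative_monomial, Nat.add_sub_cancel]
    push_cast
    rw [div_mul_cancel₀ _ (Nat.cast_add_one_ne_zero n)]

theorem lienardQ_eq_iff {f g a b : ℂ[X]} :
    lienardQ f g = C a * X - C b ↔ f = -a ∧ g = b := by
  constructor
  · intro h
    have h0 := congrArg (fun P => coeff P 0) h
    have h1 := congrArg (fun P => coeff P 1) h
    simp [lienardQ] at h0 h1
    exact ⟨by rw [← h1, neg_neg], h0⟩
  · rintro ⟨rfl, rfl⟩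
    rw [lienardQ, C_neg]
    ring

/-- A function whose logarithmic form annihilates the vector field is constant along solutions, in
real or complex time. -/
theorem HasClosedLogForm.constantAlongSolutions {𝕜 : Type} [RCLike 𝕜] [NormedAlgebra 𝕜 ℂ]
    {P Q U V H : ℂ[X][X]} {D : Set (ℂ × ℂ)} {I : ℂ × ℂ → ℂ} (hI : HasClosedLogForm D I U V H)
    (h0 : U * P + V * Q = 0) : ConstantAlongSolutions 𝕜 P Q D I := by
  intro T z hT hTc hz hzD s hs t ht
  have key : ∀ t ∈ T, HasDerivAt (I ∘ z) 0 t := by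
    intro t ht
    have h1 := ((hI.hasFDerivAt _ (hzD t ht)).restrictScalars 𝕜).comp_hasDerivAt t (hz t ht)
    refine h1.congr_deriv ?_
    have h2 := hI.denom_ne_zero _ (hzD t ht)
    have h3 : bival U (z t) * bival P (z t) + bival V (z t) * bival Q (z t) = 0 := by
      rw [← bival_mul, ← bival_mul, ← bival_add, h0, bival_zero]
    simp
    field_simp
    linear_combination I (z t) * h3
  exact hT.is_const_of_deriv_eq_zero hTc (f := I ∘ z)
    (fun t ht => (key t ht).differentiableAt.differentiableWithinAt)
    (fun t ht => (key t ht).deriv) hs ht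

/-- The shear `(x, y) ↦ (x, y + q(x))` maps the connected set `ℂ × ℂ∖{0}` onto it. -/
theorem isConnected_compl_graph (q : ℂ[X]) : IsConnected {p : ℂ × ℂ | p.2 - q.eval p.1 ≠ 0} := by
  have h : IsConnected ((Set.univ : Set ℂ) ×ˢ ({0}ᶜ : Set ℂ)) :=
    isConnected_univ.prod (isConnected_compl_singleton_of_one_lt_rank (by simp) 0)
  have h2 := h.image (fun p : ℂ × ℂ => (p.1, p.2 + q.eval p.1)) (by fun_prop)
  convert h2 using 1
  ext ⟨x, y⟩
  simp only [Set.mem_ofPred_eq, Set.mem_image, Set.mem_prod, Set.mem_univ, true_and,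
    Set.mem_compl_iff, Set.mem_singleton_iff, Prod.mk.injEq, Prod.exists]
  constructor
  · intro hxy
    exact ⟨x, y - q.eval x, hxy, rfl, by ring⟩
  · rintro ⟨x', y', hy', rfl, rfl⟩
    simpa using hy'

theorem isOpen_compl_graph (q : ℂ[X]) : IsOpen {p : ℂ × ℂ | p.2 - q.eval p.1 ≠ 0} :=
  isOpen_ne_fun (by fun_prop) continuous_const

/-- A polynomial without zeros on `D` is a branch of its first power. -/
theorem isPowerBranchOn_one {D : Set (ℂ × ℂ)} {F : ℂ[X][X]} (hF : ∀ p ∈ D, bival F p ≠ 0) :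
    IsPowerBranchOn D F 1 (bival F) := by
  intro p hp
  have hd : Differentiable ℂ (bival F) := fun p => (hasFDerivAt_bival F p).differentiableAt
  have hFp := hF p hp
  have hd' : Differentiable ℂ fun p' => bival F p' / bival F p  := by
    simpa only [div_eq_mul_inv] using hd.mul_const _
  -- Dividing by the value at `p` moves that value to `1`, where the principal logarithm is
  -- holomorphic.
  refine ⟨(fun p' => bival F p' / bival F p) ⁻¹' Complex.slitPlane,
    fun p' => Complex.log (bival F p' / bival F p) + Complex.log (bival F p),
    Complex.isOpen_slitPlane.preimage hd'.continuous, ?_, ?_, ?_⟩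
  · simp [div_self hFp]
  · exact (hd'.differentiableOn.clog fun p' hp' => hp').add_const _
  · rintro p' ⟨-, hp'⟩
    have : Complex.exp (Complex.log (bival F p' / bival F p) + Complex.log (bival F p)) =
        bival F p' := by
      rw [Complex.exp_add, Complex.exp_log (div_ne_zero (hF p' hp') hFp), Complex.exp_log hFp,
        div_mul_cancel₀ _ hFp]
    exact ⟨this, by rw [one_mul, this]⟩

theorem isDarbouxFirstIntegralOn_lienard {f g q : ℂ[X]} (hq : 0 < q.degree)
    (h : lienardQ f g = C (2 * derivative q) * X - C (q * derivative q)) :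
    IsDarbouxFirstIntegralOn lienardP (lienardQ f g) {p | p.2 - q.eval p.1 ≠ 0}
      (fun p => (p.2 - q.eval p.1) * Complex.exp (-(q.eval p.1 / (p.2 - q.eval p.1)))) := by
  set D : Set (ℂ × ℂ) := {p | p.2 - q.eval p.1 ≠ 0} with hD
  have hval : ∀ p : ℂ × ℂ, bival (X - C q) p = p.2 - q.eval p.1 := fun p => by
    rw [bival_sub, bival_X, bival_C]
  have hne : ∀ p ∈ D, bival (X - C q) p ≠ 0 := fun p hp => by rw [hval]; exact hp
  have hdar : IsDarbouxFunctionOn D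
      (fun p => (p.2 - q.eval p.1) * Complex.exp (-(q.eval p.1 / (p.2 - q.eval p.1)))) := by
    refine ⟨1, fun _ => X - C q, fun _ => 1, fun _ => bival (X - C q), -C q, X - C q,
      fun _ => isPowerBranchOn_one hne, hne, fun p hp => ?_⟩
    simp [hval, bival_neg, bival_C, neg_div]
  have hlog := ((HasClosedLogForm.of_isPowerBranchOn (isOpen_compl_graph q)
    (isPowerBranchOn_one hne)).mul (HasClosedLogForm.exp_div (-C q) (X - C q) hne)).congr
    (J := fun p => (p.2 - q.eval p.1) * Complex.exp (-(q.eval p.1 / (p.2 - q.eval p.1))))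
    (isOpen_compl_graph q) (fun p hp => by simp [hval, bival_neg, bival_C, neg_div])
  have hzero : (C (C 1) * xDeriv (X - C q) * ((X - C q) * (X - C q)) +
      (xDeriv (-C q) * (X - C q) - -C q * xDeriv (X - C q)) * (X - C q)) * lienardP +
      (C (C 1) * derivative (X - C q) * ((X - C q) * (X - C q)) +
      (derivative (-C q) * (X - C q) - -C q * derivative (X - C q)) * (X - C q)) *
        lienardQ f g = 0 := by
    rw [h, lienardP, map_neg, map_sub, xDeriv_X, xDeriv_C, two_mul]
    simp only [derivative_neg, derivative_sub, derivative_X, derivative_C, C_add, C_mul, C_1]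
    ring
  refine ⟨⟨isOpen_compl_graph q, isConnected_compl_graph q, ?_,
    hlog.constantAlongSolutions hzero, hlog.constantAlongSolutions hzero⟩, hdar⟩
  -- Above a root of `q` the integral equals `y`, hence is not constant.
  obtain ⟨x, hx⟩ := Complex.exists_root hq
  rw [IsRoot] at hx
  exact ⟨(x, 1), by simp [hD, hx], (x, 2), by simp [hD, hx], by simp [hx]⟩

theorem theoremT (m : ℕ) (f g : ℂ[X]) (hf : f.degree = (m : ℕ))
    (hg : g.degree = (2 * m + 1 : ℕ))
    (hδ : 4 * ((m : ℂ) + 1) * g.leadingCoeff = f.leadingCoeff ^ 2) :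
    (IsDarbouxIntegrable lienardP (lienardQ f g) ↔
      ∃ q : ℂ[X], q.degree = (m + 1 : ℕ) ∧
        lienardQ f g = C (2 * derivative q) * X - C (q * derivative q)) ∧
    ∀ q : ℂ[X], q.degree = (m + 1 : ℕ) →
      lienardQ f g = C (2 * derivative q) * X - C (q * derivative q) →
      IsDarbouxFirstIntegralOn lienardP (lienardQ f g) {p | p.2 - q.eval p.1 ≠ 0}
        (fun p => (p.2 - q.eval p.1) * Complex.exp (-(q.eval p.1 / (p.2 - q.eval p.1)))) := by
  have hpos : ∀ q : ℂ[X], q.degree = (m + 1 : ℕ) → 0 < q.degree := fun q hq => by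
    rw [hq]
    exact_mod_cast Nat.succ_pos m
  refine ⟨⟨fun h => ?_, fun ⟨q, hq, h⟩ =>
    ⟨_, _, isDarbouxFirstIntegralOn_lienard (hpos q hq) h⟩⟩,
    fun q hq h => isDarbouxFirstIntegralOn_lienard (hpos q hq) h⟩
  have hfn := natDegree_eq_of_degree_eq_some hf
  have hgn := natDegree_eq_of_degree_eq_some hg
  obtain ⟨q, hq⟩ := exists_derivative_eq (C (-(1 / 2)) * f)
  have hfq : f = -(2 * derivative q) := by
    have h2 : (2 : ℂ[X]) * C (1 / 2) = 1 := by
      rw [← map_ofNat C 2, ← C_mul, mul_one_div_cancel two_ne_zero, C_1]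
    rw [hq, C_neg]
    linear_combination -f * h2
  have hqd : q.natDegree ≤ m + 1 :=
    natDegree_le_succ_of_derivative (hq ▸ (natDegree_C_mul_le _ _).trans hfn.le)
  have hm0 : (m : ℂ) + 1 ≠ 0 := Nat.cast_add_one_ne_zero m
  have hlf : f.leadingCoeff = -2 * (((m : ℂ) + 1) * q.coeff (m + 1)) := by
    have := congrArg (fun P => coeff P m) hq
    simp only [coeff_derivative, coeff_C_mul] at this
    rw [leadingCoeff, hfn]
    linear_combination 2 * this
  have hq0 : q.coeff (m + 1) ≠ 0 := by
    intro h0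
    rw [h0, mul_zero, mul_zero, leadingCoeff_eq_zero] at hlf
    simp [hlf] at hf
  -- The condition `hδ` cancels the coefficient of `x ^ (2 * m + 1)`.
  have hres : (g - derivative q * q).natDegree ≤ 2 * m := by
    have hqd' : (derivative q).natDegree ≤ m := natDegree_derivative_le_of_le hqd
    have h1 : (g - derivative q * q).natDegree ≤ 2 * m + 1 :=
      (natDegree_sub_le_of_le hgn.le (natDegree_mul_le_of_le hqd' hqd)).trans (by omega)
    have h2 : (derivative q * q).coeff (m + (m + 1)) = _ :=
      coeff_mul_add_eq_of_natDegree_le hqd' hqd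
    have h3 : (g - derivative q * q).coeff (2 * m + 1) = 0 := by
      rw [show m + (m + 1) = 2 * m + 1 by ring, coeff_derivative] at h2
      rw [coeff_sub, h2]
      rw [leadingCoeff, hgn, hlf] at hδ
      refine (mul_eq_zero.1 ?_).resolve_left (mul_ne_zero (by norm_num : (4 : ℂ) ≠ 0) hm0)
      linear_combination hδ
    rw [natDegree_le_iff_coeff_eq_zero]
    intro k hk
    rcases eq_or_lt_of_le (Nat.succ_le_of_lt hk) with rfl | hk'
    · exact h3
    · exact coeff_eq_zero_of_natDegree_lt (by omega)
  obtain ⟨A, B, hA, hB, hAB⟩ := h.exists_integrating_factor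
  have hform : lienardQ f g = C (2 * derivative q) * X - C g :=
    lienardQ_eq_iff.2 ⟨hfq, rfl⟩
  rw [hform, show lienardP = X + C 0 by simp [lienardP], hfq] at hAB
  obtain ⟨t, ht, ht0, hgt⟩ := exists_integrable_form hqd hq0 hres hA hB hAB
  refine ⟨q + t, ?_, ?_⟩
  · refine degree_eq_of_le_of_coeff_ne_zero
      (natDegree_le_iff_degree_le.1 (natDegree_add_le_succ hqd ht)) ?_
    rw [coeff_add, coeff_eq_zero_of_natDegree_lt (show t.natDegree < m + 1 by omega), add_zero]
    exact hq0
  · rw [derivative_add, ht0, add_zero]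
    exact lienardQ_eq_iff.2 ⟨hfq, by rw [hgt, mul_comm]⟩
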